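/- Let $\mathbb{F}$ be a field of characteristic zero, $G$ a finite group with identity $e$, and $k$ a natural number. Let $K=\mathbb{F}(x_{h,g}^{(i)} : h,g\in G,\ 1\le i\le k)$ be the field of rational functions in algebraically independent indeterminates, and let $M_{|G|}(K)$ be the algebra of matrices with rows and columns indexed by $G$ and matrix units $E_{h,h'}$, graded by $G$ with degree $g$ component $\mathrm{span}_K\{E_{h,h'} : h^{-1}h'=g\}$. For $g\in G$ and $1\le i\le k$ let $X_{g,i}=\sum_{h\in G}x_{h,hg}^{(i)}E_{h,hg}$ (the generic matrix of degree $g$), let $R_{G,k}\subseteq M_{|G|}(K)$ be the unital $\mathbb{F}$-subalgebra generated by all $X_{g,i}$, and let the generic $G$-crossed product $D_{G,k}\subseteq M_{|G|}(K)$ be obtained from $R_{G,k}$ by inverting all its nonzero central elements (these are invertible matrices). Let $(D_{G,k})_e$ be the degree $e$ component of $D_{G,k}$, i.e. the subalgebra of its elements of degree $e$. Let $\mathbb{L}\le K$ be the field extension of $\mathbb{F}$ generated by all monomials $$x_{h,hg_1}^{(j_1)}\,x_{hg_1,hg_1g_2}^{(j_2)}\cdots x_{hg_1\cdots g_{m-1},\,hg_1\cdots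 g_m}^{(j_m)}$$ with $m\in\mathbb{N}$, $1\le j_1,\dots,j_m\le k$, $h,g_1,\dots,g_m\in G$ and $g_1\cdots g_m=e$. Let $G$ act on $K$ by $\mathbb{F}$-automorphisms with $\sigma(x_{h,g}^{(i)})=x_{\sigma h,\sigma g}^{(i)}$; this action preserves $\mathbb{L}$. Then $(D_{G,k})_e\cong\mathbb{L}$ and $Z(D_{G,k})\cong\mathbb{L}^G$ as $\mathbb{F}$-algebras. Moreover $Z(D_{G,k})\subseteq(D_{G,k})_e$, and the two isomorphisms can be chosen compatibly, the second being the restriction of the first. -/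

import Mathlib

namespace GenericCrossedProduct

section Field

variable (F G : Type*) [Field F] (k : ℕ)

/-- The rational function field `F(x_{h,g}^{(i)})` in algebraically independent indeterminates
indexed by `h, g ∈ G` and `i ∈ {1, …, k}` (here `i : Fin k`). -/
abbrev GenField : Type _ := FractionRing (MvPolynomial (G × G × Fin k) F)

/-- The indeterminate `x_{h,g}^{(i)}`. -/
noncomputable def x (h g : G) (i : Fin k) : GenField F G k :=
  algebraMap (MvPolynomial (G × G × Fin k) F) (GenField F G k) (MvPolynomial.X (h, g, i))

theorem x_ne_zero {F G : Type*} [Field F] {k : ℕ} (h g : G) (i : Fin k) : x F G k h g i ≠ 0 := by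
  unfold x
  rw [Ne, FaithfulSMul.algebraMap_eq_zero_iff]
  exact MvPolynomial.X_ne_zero _

theorem x_injective {F G : Type*} [Field F] {k : ℕ} {h g h' g' : G} {i i' : Fin k}
    (e : x F G k h g i = x F G k h' g' i') : h = h' ∧ g = g' ∧ i = i' := by
  have := MvPolynomial.X_injective (IsFractionRing.injective _ _ e)
  simpa [Prod.ext_iff] using this

variable [Group G]

/-- The permutation of the indeterminates induced by left translation by `σ`. -/
def shift (σ : G) : (G × G × Fin k) ≃ (G × G × Fin k) :=
  (Equiv.mulLeft σ).prodCongr ((Equiv.mulLeft σ).prodCongr (Equiv.refl _))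

/-- The automorphism of `F(x_{h,g}^{(i)})` over `F` with `x_{h,g}^{(i)} ↦ x_{σh,σg}^{(i)}`. -/
noncomputable def actEquiv (σ : G) : GenField F G k ≃ₐ[F] GenField F G k :=
  IsFractionRing.algEquivOfAlgEquiv (MvPolynomial.renameEquiv F (shift G k σ))

theorem actEquiv_algebraMap (σ : G) (p : MvPolynomial (G × G × Fin k) F) :
    actEquiv F G k σ (algebraMap _ _ p) =
      algebraMap _ _ (MvPolynomial.rename (shift G k σ) p) :=
  IsFractionRing.algEquivOfAlgEquiv_algebraMap _ p

theorem actEquiv_x (σ h g : G) (i : Fin k) :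
    actEquiv F G k σ (x F G k h g i) = x F G k (σ * h) (σ * g) i := by
  simp [x, actEquiv_algebraMap, shift]

/-- The action of `G` on `F(x_{h,g}^{(i)})` by `F`-automorphisms. -/
noncomputable def act : G →* (GenField F G k ≃ₐ[F] GenField F G k) where
  toFun := actEquiv F G k
  map_one' := by
    ext y
    obtain ⟨p, q, -, rfl⟩ := IsFractionRing.div_surjective (MvPolynomial (G × G × Fin k) F) y
    have h : (shift G k 1 : G × G × Fin k → G × G × Fin k) = id := by
      funext v; simp [shift]
    simp [actEquiv_algebraMap, h]
  map_mul' σ τ := by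
    ext y
    obtain ⟨p, q, -, rfl⟩ := IsFractionRing.div_surjective (MvPolynomial (G × G × Fin k) F) y
    have h : (shift G k (σ * τ) : G × G × Fin k → G × G × Fin k) = shift G k σ ∘ shift G k τ := by
      funext ⟨a, b, i⟩; simp [shift, mul_assoc]
    simp [actEquiv_algebraMap, h, MvPolynomial.rename_rename]

/-- The monomial of a path from `h` with steps `(g₁,j₁), …, (g_m,j_m)`:
`x_{h,hg₁}^{(j₁)} x_{hg₁,hg₁g₂}^{(j₂)} ⋯ x_{hg₁⋯g_{m-1},hg₁⋯g_m}^{(j_m)}`. -/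
noncomputable def pathMonomial : G → List (G × Fin k) → GenField F G k
  | _, [] => 1
  | h, s :: w => x F G k h (h * s.1) s.2 * pathMonomial (h * s.1) w

/-- The monomials of closed paths (cycles): those with `g₁ ⋯ g_m = e`. -/
def cycleMonomials : Set (GenField F G k) :=
  {y | ∃ (h : G) (w : List (G × Fin k)), (w.map Prod.fst).prod = 1 ∧ y = pathMonomial F G k h w}

/-- The field `L ≤ F(x_{h,g}^{(i)})` generated over `F` by the cycle monomials. -/
noncomputable def cycleField : IntermediateField F (GenField F G k) :=
  IntermediateField.adjoin F (cycleMonomials F G k)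

theorem act_pathMonomial (σ h : G) (w : List (G × Fin k)) :
    act F G k σ (pathMonomial F G k h w) = pathMonomial F G k (σ * h) w := by
  induction w generalizing h with
  | nil => simp [pathMonomial]
  | cons s w ih =>
    simp only [pathMonomial, map_mul, ih, mul_assoc]
    congr 1
    exact (actEquiv_x F G k σ h (h * s.1) s.2)

/-- `L` is stable under `G`, so that `G` acts on `L`. -/
theorem act_mem_cycleField (σ : G) {y : GenField F G k} (hy : y ∈ cycleField F G k) :
    act F G k σ y ∈ cycleField F G k := by
  have h : cycleField F G k ≤ (cycleField F G k).comap (act F G k σ).toAlgHom := by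
    refine IntermediateField.adjoin_le_iff.2 ?_
    rintro _ ⟨h, w, hw, rfl⟩
    refine IntermediateField.subset_adjoin F _ ⟨σ * h, w, hw, ?_⟩
    exact act_pathMonomial F G k σ h w
  exact h hy

/-- The invariant field `L^G`. -/
noncomputable def cycleFieldInvariants : IntermediateField F (GenField F G k) :=
  cycleField F G k ⊓ IntermediateField.fixedField (act F G k).range

theorem mem_cycleFieldInvariants {y : GenField F G k} :
    y ∈ cycleFieldInvariants F G k ↔ y ∈ cycleField F G k ∧ ∀ σ : G, act F G k σ y = y := by
  simp [cycleFieldInvariants, IntermediateField.mem_inf, IntermediateField.mem_fixedField_iff]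

end Field

section Algebra

variable (F G : Type*) [Field F] [Group G] [Fintype G] [DecidableEq G] (k : ℕ)

/-- The matrix algebra `M_{|G|}(F(x_{h,g}^{(i)}))`, with rows and columns indexed by `G`. -/
abbrev GenMatrix : Type _ := Matrix G G (GenField F G k)

/-- The degree `g` component of the crossed product grading on the matrix algebra: the span of
the matrix units `E_{h,h'}` with `h⁻¹ h' = g`. -/
noncomputable def gradedComponent (g : G) : Submodule (GenField F G k) (GenMatrix F G k) :=
  Submodule.span _ {M | ∃ h h' : G, h⁻¹ * h' = g ∧ M = Matrix.single h h' 1}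

/-- The permutation matrix `P_g = ∑_h E_{h,hg}`. -/
noncomputable def permMatrix (g : G) : GenMatrix F G k :=
  ∑ h : G, Matrix.single h (h * g) 1

/-- The `g`-generic matrix `X_{g,i} = diag(x_{h,hg}^{(i)})_h P_g`. -/
noncomputable def genericMatrix (g : G) (i : Fin k) : GenMatrix F G k :=
  Matrix.diagonal (fun h => x F G k h (h * g) i) * permMatrix F G k g

/-- `R_{G,k}`: the unital `F`-subalgebra generated by the generic matrices `X_{g,i}`. -/
noncomputable def genericAlgebra : Subalgebra F (GenMatrix F G k) :=
  Algebra.adjoin F {M | ∃ (g : G) (i : Fin k), M = genericMatrix F G k g i}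

/-- The nonzero central elements of `R_{G,k}`, as matrices. -/
def nonzeroCentral : Set (GenMatrix F G k) :=
  {z | z ∈ genericAlgebra F G k ∧ z ≠ 0 ∧ ∀ a ∈ genericAlgebra F G k, z * a = a * z}

/-- The generic crossed product `D_{G,k}`: `R_{G,k}` with all its nonzero central elements
inverted, realised inside the matrix algebra (where they are invertible, see
`isUnit_of_mem_nonzeroCentral`; `mem_genericCrossedProduct_iff` says that the elements are
exactly the fractions `z⁻¹ a`). -/
noncomputable def genericCrossedProduct : Subalgebra F (GenMatrix F G k) :=
  Algebra.adjoin F ((genericAlgebra F G k : Set (GenMatrix F G k)) ∪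
    {y | ∃ z ∈ nonzeroCentral F G k, z * y = 1})

variable {F G k}

theorem mem_gradedComponent {g : G} {M : GenMatrix F G k} :
    M ∈ gradedComponent F G k g ↔ ∀ h h' : G, h⁻¹ * h' ≠ g → M h h' = 0 := by
  constructor
  · intro hM
    induction hM using Submodule.span_induction with
    | mem M hM =>
      obtain ⟨a, b, hab, rfl⟩ := hM
      intro h h' hne
      rw [Matrix.single_apply, if_neg]
      rintro ⟨rfl, rfl⟩
      exact hne hab
    | zero => simp
    | add M N _ _ hM hN => intro h h' hne; simp [hM h h' hne, hN h h' hne]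
    | smul c M _ hM => intro h h' hne; simp [hM h h' hne]
  · intro hM
    rw [Matrix.matrix_eq_sum_single M]
    refine Submodule.sum_mem _ fun a _ => Submodule.sum_mem _ fun b _ => ?_
    by_cases hab : a⁻¹ * b = g
    · have : Matrix.single a b (M a b) = M a b • Matrix.single a b (1 : GenField F G k) := by
        simp [Matrix.smul_single]
      rw [this]
      exact Submodule.smul_mem _ _ (Submodule.subset_span ⟨a, b, hab, rfl⟩)
    · simp [hM a b hab]

theorem permMatrix_apply (g h h' : G) :
    permMatrix F G k g h h' = if h' = h * g then 1 else 0 := by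
  simp only [permMatrix, Matrix.sum_apply, Matrix.single_apply]
  rw [Finset.sum_eq_single h]
  · simp [eq_comm]
  · rintro b - hb; simp [hb]
  · simp

theorem genericMatrix_apply (g h h' : G) (i : Fin k) :
    genericMatrix F G k g i h h' = if h' = h * g then x F G k h h' i else 0 := by
  rw [genericMatrix, Matrix.diagonal_mul, permMatrix_apply]
  split_ifs with e
  · simp [e]
  · simp

theorem genericMatrix_mem (g : G) (i : Fin k) :
    genericMatrix F G k g i ∈ genericAlgebra F G k :=
  Algebra.subset_adjoin ⟨g, i, rfl⟩

theorem exists_scalar_of_mem_nonzeroCentral {z : GenMatrix F G k}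
    (hz : z ∈ nonzeroCentral F G k) :
    ∃ c : GenField F G k, c ≠ 0 ∧ z = Matrix.scalar G c := by
  obtain ⟨hR, h0, hc⟩ := hz
  suffices h : ∃ c : GenField F G k, z = Matrix.scalar G c by
    obtain ⟨c, rfl⟩ := h
    exact ⟨c, fun hc0 => h0 (by rw [hc0, map_zero]), rfl⟩
  rcases Nat.eq_zero_or_pos k with rfl | hk
  · have he : {M | ∃ (g : G) (i : Fin 0), M = genericMatrix F G 0 g i} = ∅ := by
      ext M; simp
    rw [genericAlgebra, he, Algebra.adjoin_empty] at hR
    obtain ⟨c, hc⟩ := Algebra.mem_bot.1 hR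
    exact ⟨algebraMap F _ c, by rw [← hc]; rfl⟩
  · let i : Fin k := ⟨0, hk⟩
    have hoff : ∀ h h' : G, h ≠ h' → z h h' = 0 := by
      intro h h' hne
      have e := congrFun (congrFun (hc _ (genericMatrix_mem 1 i)) h) h'
      simp only [Matrix.mul_apply, genericMatrix_apply, mul_one, mul_ite, mul_zero, ite_mul,
        zero_mul, Finset.sum_ite_eq, Finset.sum_ite_eq', Finset.mem_univ, if_true] at e
      have e' : z h h' * (x F G k h' h' i - x F G k h h i) = 0 := by
        rw [mul_sub, e]; ring
      rcases mul_eq_zero.1 e' with e' | e'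
      · exact e'
      · exact absurd (x_injective (sub_eq_zero.1 e')).1.symm hne
    have hdiag : ∀ h h' : G, z h h = z h' h' := by
      intro h h'
      have e := congrFun (congrFun (hc _ (genericMatrix_mem (h⁻¹ * h') i)) h) h'
      rw [Matrix.mul_apply, Matrix.mul_apply, Finset.sum_eq_single h, Finset.sum_eq_single h'] at e
      · simp only [genericMatrix_apply, mul_inv_cancel_left, if_true] at e
        rw [mul_comm] at e
        exact mul_left_cancel₀ (x_ne_zero h h' i) e
      · intro b _ hb; rw [hoff b h' hb, mul_zero]
      · simp
      · intro b _ hb; rw [hoff h b hb.symm, zero_mul]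
      · simp
    refine ⟨z 1 1, ?_⟩
    ext h h'
    by_cases e : h = h'
    · subst e; simpa using hdiag h 1
    · simp [e, hoff h h' e]

theorem isUnit_of_mem_nonzeroCentral {z : GenMatrix F G k} (hz : z ∈ nonzeroCentral F G k) :
    IsUnit z := by
  obtain ⟨c, hc, rfl⟩ := exists_scalar_of_mem_nonzeroCentral hz
  exact (IsUnit.mk0 c hc).map (Matrix.scalar G)

theorem mul_mem_nonzeroCentral {z w : GenMatrix F G k} (hz : z ∈ nonzeroCentral F G k)
    (hw : w ∈ nonzeroCentral F G k) : z * w ∈ nonzeroCentral F G k := by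
  refine ⟨mul_mem hz.1 hw.1, ?_, fun a ha => ?_⟩
  · intro h
    exact hw.2.1 ((isUnit_of_mem_nonzeroCentral hz).mul_right_eq_zero.1 h)
  · rw [mul_assoc, hw.2.2 a ha, ← mul_assoc, hz.2.2 a ha, mul_assoc]

theorem commute_of_mem_nonzeroCentral {z : GenMatrix F G k} (hz : z ∈ nonzeroCentral F G k)
    (M : GenMatrix F G k) : z * M = M * z := by
  obtain ⟨c, hc, rfl⟩ := exists_scalar_of_mem_nonzeroCentral hz
  exact Matrix.scalar_commute c (fun r' => Commute.all c r') M

theorem one_mem_nonzeroCentral : (1 : GenMatrix F G k) ∈ nonzeroCentral F G k :=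
  ⟨one_mem _, one_ne_zero, fun a _ => by simp⟩

theorem mem_genericCrossedProduct_iff {d : GenMatrix F G k} :
    d ∈ genericCrossedProduct F G k ↔
      ∃ z ∈ nonzeroCentral F G k, z * d ∈ genericAlgebra F G k := by
  constructor
  · intro hd
    induction hd using Algebra.adjoin_induction with
    | mem d hd =>
      rcases hd with hd | ⟨z, hz, e⟩
      · exact ⟨1, one_mem_nonzeroCentral, by simpa using hd⟩
      · exact ⟨z, hz, by rw [e]; exact one_mem _⟩
    | algebraMap r =>
      exact ⟨1, one_mem_nonzeroCentral, by
        rw [one_mul]; exact Subalgebra.algebraMap_mem _ r⟩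
    | add a b _ _ ha hb =>
      obtain ⟨z, hz, hza⟩ := ha
      obtain ⟨w, hw, hwb⟩ := hb
      refine ⟨z * w, mul_mem_nonzeroCentral hz hw, ?_⟩
      have e : z * w * (a + b) = w * (z * a) + z * (w * b) := by
        rw [mul_add, mul_assoc z w b, commute_of_mem_nonzeroCentral hz w, mul_assoc w z a]
      rw [e]
      exact add_mem (mul_mem hw.1 hza) (mul_mem hz.1 hwb)
    | mul a b _ _ ha hb =>
      obtain ⟨z, hz, hza⟩ := ha
      obtain ⟨w, hw, hwb⟩ := hb
      refine ⟨z * w, mul_mem_nonzeroCentral hz hw, ?_⟩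
      have e : z * w * (a * b) = (z * a) * (w * b) := by
        rw [mul_assoc z w, ← mul_assoc w a b, commute_of_mem_nonzeroCentral hw a]
        simp only [mul_assoc]
      rw [e]
      exact mul_mem hza hwb
  · rintro ⟨z, hz, hzd⟩
    obtain ⟨u, hu⟩ := isUnit_of_mem_nonzeroCentral hz
    have e : d = (↑u⁻¹ : GenMatrix F G k) * (z * d) := by
      rw [← hu, Units.inv_mul_cancel_left]
    rw [e]
    refine mul_mem (Algebra.subset_adjoin (Or.inr ⟨z, hz, ?_⟩))
      (Algebra.subset_adjoin (Or.inl hzd))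
    rw [← hu, Units.mul_inv]

variable (F G k)

/-- The identity component `(D_{G,k})_e` for the crossed product grading. -/
noncomputable def identityComponent : Subalgebra F (genericCrossedProduct F G k) where
  carrier := {d | (d : GenMatrix F G k) ∈ gradedComponent F G k 1}
  mul_mem' := by
    intro a b ha hb
    replace ha := mem_gradedComponent.1 ha
    replace hb := mem_gradedComponent.1 hb
    refine mem_gradedComponent.2 ?_
    intro h h' hne
    rw [MulMemClass.coe_mul, Matrix.mul_apply]
    refine Finset.sum_eq_zero fun j _ => ?_
    by_cases e : h⁻¹ * j = 1
    · have : h = j := inv_mul_eq_one.1 e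
      subst this
      rw [hb _ _ hne, mul_zero]
    · rw [ha _ _ e, zero_mul]
  add_mem' := by
    intro a b ha hb
    exact (gradedComponent F G k 1).add_mem ha hb
  algebraMap_mem' := by
    intro r
    refine mem_gradedComponent.2 ?_
    intro h h' hne
    have : h ≠ h' := fun e => hne (inv_mul_eq_one.2 e)
    rw [Subalgebra.coe_algebraMap, Matrix.algebraMap_matrix_apply, if_neg this]

end Algebra

end GenericCrossedProduct

namespace GenericCrossedProduct

/-! ### Closed paths, tours and the monomials they carry -/

section Paths

variable {F G : Type*} [Field F] [Group G] {k : ℕ}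

/-! Both isomorphisms are inverse to restrictions of the embedding `y ↦ diag (h(y))_h` of `K` in the
matrices (`lift`), so both read off the entry at `(1, 1)`.

Entries of elements of `D` are equivariant, `σ (d h h') = d (σ h) (σ h')`, and diagonal ones lie in
`L`. Hence an element of degree `e` is the lift of its `(1, 1)` entry. Central elements are scalar,
so equivariance makes their entry `G`-invariant.

The substance is that every `y ∈ L` lifts into `D` (`lift_mem_genericCrossedProduct`). A closed path
from `1` lifts to a product of generic matrices, but one based at `h` need not have the monomial of
a closed path from `1`. Multiplying by the monomial `m` of a tour, a closed path from `1` through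
all of `G`, repairs this: the cycle can be inserted where the tour passes `h` (`mul_mem_tourSpan`).
To lift `b / c`, the denominator is replaced by the norm `∏ h, h(m c)`, which is invariant and so
lifts to a central element of `R`. -/

theorem pathMonomial_append (h : G) (u v : List (G × Fin k)) :
    pathMonomial F G k h (u ++ v) =
      pathMonomial F G k h u * pathMonomial F G k (h * (u.map Prod.fst).prod) v := by
  induction u generalizing h with
  | nil => simp [pathMonomial]
  | cons s u ih => simp [pathMonomial, ih, mul_assoc]

theorem pathMonomial_ne_zero (h : G) (w : List (G × Fin k)) : pathMonomial F G k h w ≠ 0 := by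
  induction w generalizing h with
  | nil => simp [pathMonomial]
  | cons s w ih => exact mul_ne_zero (x_ne_zero _ _ _) (ih _)

/-- A closed path starting at `1` that visits every element of the set `T`. -/
def IsTour (T : Set G) (w : List (G × Fin k)) : Prop :=
  (w.map Prod.fst).prod = 1 ∧ ∀ h ∈ T, ∃ u v, w = u ++ v ∧ (u.map Prod.fst).prod = h

theorem exists_isTour_univ [Finite G] (i : Fin k) :
    ∃ w : List (G × Fin k), IsTour Set.univ w := by
  refine Set.Finite.induction_on (motive := fun T _ => ∃ w : List (G × Fin k), IsTour T w)
    Set.univ Set.finite_univ ⟨[], by simp [IsTour]⟩ ?_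
  rintro a T - - ⟨w, hw, hT⟩
  -- The detour from `1` to `a` and back returns to `1`, so the stops of `w` are unchanged.
  refine ⟨[(a, i), (a⁻¹, i)] ++ w, by simp [hw], ?_⟩
  rintro h (rfl | hh)
  · exact ⟨[(h, i)], (h⁻¹, i) :: w, by simp, by simp⟩
  · obtain ⟨u, v, rfl, hu⟩ := hT h hh
    exact ⟨[(a, i), (a⁻¹, i)] ++ u, v, by simp, by simp [hu]⟩

/-- Inserting a closed path into a tour where it passes through the base point. -/
theorem IsTour.insert {T : Set G} {u v c : List (G × Fin k)} (hw : IsTour T (u ++ v))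
    (hc : (c.map Prod.fst).prod = 1) : IsTour T (u ++ c ++ v) := by
  refine ⟨by simpa [hc] using hw.1, fun h hh => ?_⟩
  obtain ⟨p, q, e, hp⟩ := hw.2 h hh
  -- The stop at `h` comes either after or before the insertion point; since `c` is closed, it does
  -- not move the later stops.
  rcases List.append_eq_append_iff.1 e with ⟨a, rfl, rfl⟩ | ⟨a, rfl, rfl⟩
  · exact ⟨u ++ c ++ a, q, by simp, by simpa [hc] using hp⟩
  · exact ⟨p, a ++ c ++ v, by simp, hp⟩

variable (F G k)

/-- The span of the monomials of tours of the whole group. -/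
noncomputable def tourSpan : Submodule F (GenField F G k) :=
  Submodule.span F {y | ∃ w, IsTour Set.univ w ∧ y = pathMonomial F G k 1 w}

variable {F G k}

/-- A tour passes through the base point of any cycle; inserting the cycle there multiplies the
monomials and leaves a tour. -/
theorem mul_mem_tourSpan {s b : GenField F G k} (hs : s ∈ tourSpan F G k)
    (hb : b ∈ Algebra.adjoin F (cycleMonomials F G k)) : s * b ∈ tourSpan F G k := by
  induction hb using Algebra.adjoin_induction generalizing s with
  | mem b hb =>
    obtain ⟨h, c, hc, rfl⟩ := hb
    induction hs using Submodule.span_induction with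
    | mem s hs =>
      obtain ⟨w, hw, rfl⟩ := hs
      obtain ⟨u, v, rfl, hu⟩ := hw.2 h trivial
      refine Submodule.subset_span ⟨_, hw.insert hc, ?_⟩
      simp only [pathMonomial_append, List.map_append, List.prod_append, hu, hc, one_mul, mul_one]
      ring
    | zero => simp
    | add s t _ _ hs ht => rw [add_mul]; exact add_mem hs ht
    | smul r s _ hs => rw [smul_mul_assoc]; exact Submodule.smul_mem _ _ hs
  | algebraMap r => rw [mul_comm, ← Algebra.smul_def]; exact Submodule.smul_mem _ _ hs
  | add a b _ _ ha hb => rw [mul_add]; exact add_mem (ha hs) (hb hs)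
  | mul a b _ _ ha hb => rw [← mul_assoc]; exact hb (ha hs)

theorem act_mem_adjoin_cycleMonomials (σ : G) {y : GenField F G k}
    (hy : y ∈ Algebra.adjoin F (cycleMonomials F G k)) :
    act F G k σ y ∈ Algebra.adjoin F (cycleMonomials F G k) := by
  induction hy using Algebra.adjoin_induction with
  | mem y hy =>
    obtain ⟨h, w, hw, rfl⟩ := hy
    exact Algebra.subset_adjoin ⟨σ * h, w, hw, act_pathMonomial F G k σ h w⟩
  | algebraMap r => rw [AlgEquiv.commutes]; exact Subalgebra.algebraMap_mem _ r
  | add a b _ _ ha hb => rw [map_add]; exact add_mem ha hb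
  | mul a b _ _ ha hb => rw [map_mul]; exact mul_mem ha hb

theorem act_prod_act [Fintype G] (σ : G) (y : GenField F G k) :
    act F G k σ (∏ h, act F G k h y) = ∏ h, act F G k h y := by
  rw [map_prod]
  refine Fintype.prod_equiv (Equiv.mulLeft σ) _ _ fun h => ?_
  simp [map_mul]

variable (F k) in
/-- The span of the monomials of paths from `h` to `h'`. -/
noncomputable def pathSpan (h h' : G) : Submodule F (GenField F G k) :=
  Submodule.span F {y | ∃ w, h * (w.map Prod.fst).prod = h' ∧ y = pathMonomial F G k h w}

theorem mul_mem_pathSpan {h j h' : G} {a b : GenField F G k} (ha : a ∈ pathSpan F k h j)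
    (hb : b ∈ pathSpan F k j h') : a * b ∈ pathSpan F k h h' := by
  have hab := Submodule.mul_mem_mul ha hb
  rw [pathSpan, pathSpan, Submodule.span_mul_span] at hab
  refine Submodule.span_mono ?_ hab
  rintro _ ⟨_, ⟨u, rfl, rfl⟩, _, ⟨v, rfl, rfl⟩, rfl⟩
  exact ⟨u ++ v, by simp [mul_assoc], (pathMonomial_append h u v).symm⟩

theorem pathSpan_self_le (h : G) :
    pathSpan F k h h ≤ (cycleField F G k).toSubalgebra.toSubmodule := by
  refine Submodule.span_le.2 ?_
  rintro _ ⟨w, hw, rfl⟩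
  exact IntermediateField.subset_adjoin F _ ⟨h, w, mul_eq_left.1 hw, rfl⟩

/-- With no indeterminates the only path is the empty one. This case is separate because tours need
a letter to move with. -/
theorem cycleField_zero : cycleField F G 0 = ⊥ := by
  refine le_bot_iff.1 (IntermediateField.adjoin_le_iff.2 ?_)
  rintro _ ⟨h, w, -, rfl⟩
  cases w with
  | nil => exact one_mem _
  | cons s w => exact s.2.elim0

end Paths

/-! ### The diagonal embedding and its values in `R` and `D` -/

section Lift

variable {F G : Type*} [Field F] [Group G] [Fintype G] [DecidableEq G] {k : ℕ}

variable (F G k) in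
/-- The embedding of the field in the matrix algebra as the diagonal matrices `diag(h(y))_h`. -/
noncomputable def lift : GenField F G k →ₐ[F] GenMatrix F G k :=
  (Matrix.diagonalAlgHom F).comp (AlgHom.pi fun h => (act F G k h : _ →ₐ[F] GenField F G k))

theorem lift_apply (y : GenField F G k) :
    lift F G k y = Matrix.diagonal fun h => act F G k h y := rfl

theorem lift_apply_one_one (y : GenField F G k) : lift F G k y 1 1 = y := by
  simp [lift_apply]

theorem lift_eq_scalar {y : GenField F G k} (hy : ∀ σ, act F G k σ y = y) :
    lift F G k y = Matrix.scalar G y := by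
  simp [lift_apply, hy]

theorem prod_genericMatrix_apply (w : List (G × Fin k)) (h h' : G) :
    (w.map fun s => genericMatrix F G k s.1 s.2).prod h h' =
      if h' = h * (w.map Prod.fst).prod then pathMonomial F G k h w else 0 := by
  induction w generalizing h with
  | nil => simp [pathMonomial, Matrix.one_apply, eq_comm]
  | cons s w ih =>
    rw [List.map_cons, List.prod_cons, Matrix.mul_apply, Finset.sum_eq_single (h * s.1)]
    · simp [genericMatrix_apply, ih, pathMonomial, mul_assoc]
    · intro j _ hj
      rw [genericMatrix_apply, if_neg hj, zero_mul]
    · simp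

theorem lift_pathMonomial {w : List (G × Fin k)} (hw : (w.map Prod.fst).prod = 1) :
    lift F G k (pathMonomial F G k 1 w) =
      (w.map fun s => genericMatrix F G k s.1 s.2).prod := by
  ext h h'
  rw [prod_genericMatrix_apply, hw, lift_apply, Matrix.diagonal_apply, act_pathMonomial]
  simp [eq_comm]

theorem lift_mem_genericAlgebra {y : GenField F G k} (hy : y ∈ tourSpan F G k) :
    lift F G k y ∈ genericAlgebra F G k := by
  induction hy using Submodule.span_induction with
  | mem y hy =>
    obtain ⟨w, hw, rfl⟩ := hy
    rw [lift_pathMonomial hw.1]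
    refine list_prod_mem fun M hM => ?_
    obtain ⟨s, -, rfl⟩ := List.mem_map.1 hM
    exact genericMatrix_mem _ _
  | zero => simp
  | add a b _ _ ha hb => rw [map_add]; exact add_mem ha hb
  | smul r a _ ha => rw [map_smul]; exact Subalgebra.smul_mem _ ha r

theorem lift_mem_genericCrossedProduct {y : GenField F G k} (hy : y ∈ cycleField F G k) :
    lift F G k y ∈ genericCrossedProduct F G k := by
  rcases Nat.eq_zero_or_pos k with rfl | hk
  · rw [cycleField_zero] at hy
    obtain ⟨r, rfl⟩ := IntermediateField.mem_bot.1 hy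
    rw [AlgHom.commutes]
    exact Subalgebra.algebraMap_mem _ r
  obtain ⟨w, hw⟩ := exists_isTour_univ (G := G) (⟨0, hk⟩ : Fin k)
  have hm : pathMonomial F G k 1 w ∈ tourSpan F G k := Submodule.subset_span ⟨w, hw, rfl⟩
  have hmB : pathMonomial F G k 1 w ∈ Algebra.adjoin F (cycleMonomials F G k) :=
    Algebra.subset_adjoin ⟨1, w, hw.1, rfl⟩
  have hm0 := pathMonomial_ne_zero (F := F) 1 w
  generalize pathMonomial F G k 1 w = m at hm hmB hm0
  obtain ⟨b, hb, c, hc, rfl⟩ := (IntermediateField.mem_adjoin_iff_div).1 hy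
  -- The quotient presentation allows `c = 0`, where `b / c = 0`.
  rcases eq_or_ne c 0 with rfl | hc0
  · simp
  -- The norm of `m * c`: its factor at `1` is `m * c` itself, so both `n` and `n * (b / c)` are `m`
  -- times an element of the cycle algebra, and both lift into `R`.
  set n := ∏ h, act F G k h (m * c) with hn
  have hn0 : n ≠ 0 := Finset.prod_ne_zero_iff.2 fun h _ => by simp [hm0, hc0]
  have hninv : ∀ σ, act F G k σ n = n := fun σ => act_prod_act σ _
  have hP : ∏ h ∈ Finset.univ.erase (1 : G), act F G k h (m * c) ∈
      Algebra.adjoin F (cycleMonomials F G k) :=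
    prod_mem fun h _ => act_mem_adjoin_cycleMonomials h (mul_mem hmB hc)
  have hsplit : n = m * c * ∏ h ∈ Finset.univ.erase (1 : G), act F G k h (m * c) := by
    rw [hn, ← Finset.mul_prod_erase _ _ (Finset.mem_univ (1 : G))]
    simp
  refine mem_genericCrossedProduct_iff.2 ⟨lift F G k n, ⟨?_, ?_, fun a _ => ?_⟩, ?_⟩
  · rw [hsplit, mul_assoc]
    exact lift_mem_genericAlgebra (mul_mem_tourSpan hm (mul_mem hc hP))
  · exact (map_ne_zero_iff _ (lift F G k).toRingHom.injective).2 hn0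
  · rw [lift_eq_scalar hninv]
    exact Matrix.scalar_commute n (fun r' => Commute.all n r') a
  · rw [← map_mul]
    refine lift_mem_genericAlgebra ?_
    have e : n * (b / c) = m * (b * ∏ h ∈ Finset.univ.erase (1 : G), act F G k h (m * c)) := by
      rw [hsplit]
      field_simp
    rw [e]
    exact mul_mem_tourSpan hm (mul_mem hb hP)

/-! ### Entries of elements of `R` and `D`, and the center -/

theorem apply_mem_pathSpan {M : GenMatrix F G k} (hM : M ∈ genericAlgebra F G k) (h h' : G) :
    M h h' ∈ pathSpan F k h h' := by
  induction hM using Algebra.adjoin_induction generalizing h h' with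
  | mem M hM =>
    obtain ⟨g, i, rfl⟩ := hM
    rw [genericMatrix_apply]
    split_ifs with e
    · subst e
      exact Submodule.subset_span ⟨[(g, i)], by simp, by simp [pathMonomial]⟩
    · exact zero_mem _
  | algebraMap r =>
    rw [Matrix.algebraMap_matrix_apply]
    split_ifs with e
    · subst e
      rw [Algebra.algebraMap_eq_smul_one]
      exact Submodule.smul_mem _ _ (Submodule.subset_span ⟨[], by simp, by simp [pathMonomial]⟩)
    · exact zero_mem _
  | add M N _ _ hM hN => exact add_mem (hM h h') (hN h h')
  | mul M N _ _ hM hN =>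
    rw [Matrix.mul_apply]
    exact sum_mem fun j _ => mul_mem_pathSpan (hM h j) (hN j h')

/-- The edge condition `h' = h * g` is invariant under left translation, so generators are
equivariant; sums and products inherit this. -/
theorem act_apply {M : GenMatrix F G k} (hM : M ∈ genericAlgebra F G k) (σ h h' : G) :
    act F G k σ (M h h') = M (σ * h) (σ * h') := by
  induction hM using Algebra.adjoin_induction generalizing h h' with
  | mem M hM =>
    obtain ⟨g, i, rfl⟩ := hM
    rw [genericMatrix_apply, genericMatrix_apply, mul_assoc]
    simp only [mul_right_inj]
    split_ifs
    · exact actEquiv_x F G k σ h h' i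
    · exact map_zero _
  | algebraMap r =>
    rw [Matrix.algebraMap_matrix_apply, Matrix.algebraMap_matrix_apply]
    simp only [mul_right_inj]
    split_ifs
    · exact AlgEquiv.commutes _ r
    · exact map_zero _
  | add M N _ _ hM hN => simp [hM, hN]
  | mul M N _ _ hM hN =>
    rw [Matrix.mul_apply, Matrix.mul_apply, map_sum]
    refine Fintype.sum_equiv (Equiv.mulLeft σ) _ _ fun j => ?_
    simp [hM, hN]

/-- The scalar denominator is itself in `R`, so its value is a diagonal entry and lies in `L` like
the numerator's. -/
theorem apply_self_mem_cycleField {d : GenMatrix F G k} (hd : d ∈ genericCrossedProduct F G k)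
    (h : G) : d h h ∈ cycleField F G k := by
  obtain ⟨z, hz, hzd⟩ := mem_genericCrossedProduct_iff.1 hd
  obtain ⟨c, hc, rfl⟩ := exists_scalar_of_mem_nonzeroCentral hz
  have h₁ := pathSpan_self_le h (apply_mem_pathSpan hz.1 h h)
  have h₂ := pathSpan_self_le h (apply_mem_pathSpan hzd h h)
  have e : d h h = (Matrix.scalar G c * d) h h / Matrix.scalar G c h h := by
    simp [Matrix.diagonal_mul, mul_div_cancel_left₀ _ hc]
  rw [e]
  exact div_mem h₂ h₁

theorem act_apply_of_mem_genericCrossedProduct {d : GenMatrix F G k}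
    (hd : d ∈ genericCrossedProduct F G k) (σ h h' : G) :
    act F G k σ (d h h') = d (σ * h) (σ * h') := by
  obtain ⟨z, hz, hzd⟩ := mem_genericCrossedProduct_iff.1 hd
  obtain ⟨c, hc, rfl⟩ := exists_scalar_of_mem_nonzeroCentral hz
  have h₁ := act_apply hz.1 σ h h
  have h₂ := act_apply hzd σ h h'
  simp only [Matrix.scalar_apply, Matrix.diagonal_apply_eq, Matrix.diagonal_mul, map_mul] at h₁ h₂
  -- The denominator `c` is fixed by `σ`, being the entry of a scalar matrix in `R` at both `(h, h)`
  -- and `(σ h, σ h)`.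
  rw [h₁] at h₂
  exact mul_left_cancel₀ hc h₂

theorem lift_apply_one_one_eq {d : GenMatrix F G k} (hd : d ∈ genericCrossedProduct F G k)
    (he : d ∈ gradedComponent F G k 1) : lift F G k (d 1 1) = d := by
  ext h h'
  rw [lift_apply, Matrix.diagonal_apply]
  split_ifs with e
  · subst e
    simpa using act_apply_of_mem_genericCrossedProduct hd h 1 1
  · exact (mem_gradedComponent.1 he h h' fun e' => e (inv_mul_eq_one.1 e')).symm

theorem lift_mem_gradedComponent (y : GenField F G k) :
    lift F G k y ∈ gradedComponent F G k 1 := by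
  refine mem_gradedComponent.2 fun h h' hne => ?_
  rw [lift_apply, Matrix.diagonal_apply_ne]
  exact fun e => hne (inv_mul_eq_one.2 e)

/-- Clearing denominators turns a nonzero central element of `D` into a nonzero central element of
`R`, which is known to be scalar. -/
theorem exists_scalar_of_mem_center {z : genericCrossedProduct F G k}
    (hz : z ∈ Subalgebra.center F (genericCrossedProduct F G k)) :
    ∃ c, (z : GenMatrix F G k) = Matrix.scalar G c := by
  rcases eq_or_ne z 0 with rfl | hz0
  · exact ⟨0, by simp⟩
  obtain ⟨s, hs, hsz⟩ := mem_genericCrossedProduct_iff.1 z.2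
  have hmem : s * (z : GenMatrix F G k) ∈ nonzeroCentral F G k := by
    refine ⟨hsz, fun h => hz0 ?_, fun a ha => ?_⟩
    · exact Subtype.ext ((isUnit_of_mem_nonzeroCentral hs).mul_right_eq_zero.1 h)
    · have hza : (z : GenMatrix F G k) * a = a * z := congrArg Subtype.val
        (Subalgebra.mem_center_iff.1 hz ⟨a, Algebra.subset_adjoin (Or.inl ha)⟩).symm
      rw [mul_assoc, hza, ← mul_assoc, hs.2.2 a ha, mul_assoc]
  obtain ⟨c, hc, rfl⟩ := exists_scalar_of_mem_nonzeroCentral hs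
  obtain ⟨b, -, hb⟩ := exists_scalar_of_mem_nonzeroCentral hmem
  refine ⟨c⁻¹ * b, ?_⟩
  rw [map_mul, ← hb, ← mul_assoc, ← map_mul, inv_mul_cancel₀ hc, map_one, one_mul]

theorem center_le_identityComponent :
    Subalgebra.center F (genericCrossedProduct F G k) ≤ identityComponent F G k := by
  intro z hz
  obtain ⟨c, hc⟩ := exists_scalar_of_mem_center hz
  refine mem_gradedComponent.2 fun h h' hne => ?_
  rw [hc, Matrix.scalar_apply, Matrix.diagonal_apply_ne]
  exact fun e => hne (inv_mul_eq_one.2 e)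

theorem apply_one_one_mem_cycleFieldInvariants {z : genericCrossedProduct F G k}
    (hz : z ∈ Subalgebra.center F (genericCrossedProduct F G k)) :
    (z : GenMatrix F G k) 1 1 ∈ cycleFieldInvariants F G k := by
  refine (mem_cycleFieldInvariants F G k).2 ⟨apply_self_mem_cycleField z.2 1, fun σ => ?_⟩
  -- `σ` carries the `(1, 1)` entry to the `(σ, σ)` entry, and these agree in a scalar matrix.
  rw [act_apply_of_mem_genericCrossedProduct z.2]
  obtain ⟨c, hc⟩ := exists_scalar_of_mem_center hz
  simp [hc]

/-! ### The two isomorphisms -/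

variable (F G k)

/-- The embedding of `L` in `(D_{G,k})_e`. -/
noncomputable def liftIdentityComponent : cycleField F G k →ₐ[F] identityComponent F G k :=
  (((lift F G k).comp (cycleField F G k).val).codRestrict (genericCrossedProduct F G k)
    fun y => lift_mem_genericCrossedProduct y.2).codRestrict (identityComponent F G k)
      fun y => lift_mem_gradedComponent (y : GenField F G k)

theorem liftIdentityComponent_bijective :
    Function.Bijective (liftIdentityComponent F G k) := by
  refine ⟨RingHom.injective (liftIdentityComponent F G k).toRingHom, fun d => ?_⟩
  exact ⟨⟨(d : GenMatrix F G k) 1 1, apply_self_mem_cycleField d.1.2 1⟩,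
    Subtype.ext (Subtype.ext (lift_apply_one_one_eq d.1.2 d.2))⟩

/-- `(D_{G,k})_e ≅ L`, sending a diagonal matrix to its entry at the identity. -/
noncomputable def identityComponentEquiv : identityComponent F G k ≃ₐ[F] cycleField F G k :=
  (AlgEquiv.ofBijective _ (liftIdentityComponent_bijective F G k)).symm

/-- Together with `coe_centerEquiv` this gives the compatibility: both maps read off the same entry.
-/
theorem coe_identityComponentEquiv (d : identityComponent F G k) :
    (identityComponentEquiv F G k d : GenField F G k) = (d : GenMatrix F G k) 1 1 := by
  obtain ⟨y, rfl⟩ := (liftIdentityComponent_bijective F G k).2 d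
  have h : identityComponentEquiv F G k (liftIdentityComponent F G k y) = y :=
    (AlgEquiv.ofBijective _ (liftIdentityComponent_bijective F G k)).symm_apply_apply y
  rw [h]
  exact (lift_apply_one_one (y : GenField F G k)).symm

/-- The embedding of `L^G` in the center of `D_{G,k}`. -/
noncomputable def liftCenter : cycleFieldInvariants F G k →ₐ[F]
    Subalgebra.center F (genericCrossedProduct F G k) :=
  (((lift F G k).comp (cycleFieldInvariants F G k).val).codRestrict (genericCrossedProduct F G k)
    fun y => lift_mem_genericCrossedProduct
      ((mem_cycleFieldInvariants F G k).1 y.2).1).codRestrict (Subalgebra.center F _) fun y => by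
        refine Subalgebra.mem_center_iff.2 fun a => Subtype.ext ?_
        change (a : GenMatrix F G k) * lift F G k y = lift F G k y * a
        rw [lift_eq_scalar ((mem_cycleFieldInvariants F G k).1 y.2).2]
        exact (Matrix.scalar_commute _ (fun r' => Commute.all _ r') _).symm

theorem liftCenter_bijective : Function.Bijective (liftCenter F G k) := by
  refine ⟨RingHom.injective (liftCenter F G k).toRingHom, fun z => ?_⟩
  exact ⟨⟨(z : GenMatrix F G k) 1 1, apply_one_one_mem_cycleFieldInvariants z.2⟩,
    Subtype.ext (Subtype.ext (lift_apply_one_one_eq z.1.2 (center_le_identityComponent z.2)))⟩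

/-- `Z(D_{G,k}) ≅ L^G`, sending a scalar matrix to its entry at the identity. -/
noncomputable def centerEquiv :
    Subalgebra.center F (genericCrossedProduct F G k) ≃ₐ[F] cycleFieldInvariants F G k :=
  (AlgEquiv.ofBijective _ (liftCenter_bijective F G k)).symm

theorem coe_centerEquiv (z : Subalgebra.center F (genericCrossedProduct F G k)) :
    (centerEquiv F G k z : GenField F G k) = (z : GenMatrix F G k) 1 1 := by
  obtain ⟨y, rfl⟩ := (liftCenter_bijective F G k).2 z
  have h : centerEquiv F G k (liftCenter F G k y) = y :=
    (AlgEquiv.ofBijective _ (liftCenter_bijective F G k)).symm_apply_apply y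
  rw [h]
  exact (lift_apply_one_one (y : GenField F G k)).symm

end Lift

end GenericCrossedProduct

theorem mainTheorem7 (F : Type*) [Field F] [CharZero F]
    (G : Type*) [Group G] [Fintype G] [DecidableEq G] (k : ℕ) :
    ∃ (φ : GenericCrossedProduct.identityComponent F G k ≃ₐ[F]
          GenericCrossedProduct.cycleField F G k)
      (ψ : Subalgebra.center F (GenericCrossedProduct.genericCrossedProduct F G k) ≃ₐ[F]
          GenericCrossedProduct.cycleFieldInvariants F G k),
      ∀ z : Subalgebra.center F (GenericCrossedProduct.genericCrossedProduct F G k),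
        ∃ hz : (z : GenericCrossedProduct.genericCrossedProduct F G k) ∈
            GenericCrossedProduct.identityComponent F G k,
          (φ ⟨z, hz⟩ : GenericCrossedProduct.GenField F G k) = ψ z := by
  exact ⟨GenericCrossedProduct.identityComponentEquiv F G k,
    GenericCrossedProduct.centerEquiv F G k, fun z =>
      ⟨GenericCrossedProduct.center_le_identityComponent z.2, by
        rw [GenericCrossedProduct.coe_identityComponentEquiv,
          GenericCrossedProduct.coe_centerEquiv]⟩⟩
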